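/- Let $M$ be a smooth manifold (without boundary, not necessarily compact or connected) of dimension $2n$ with $n>2$, let $\omega$ be a symplectic form on $M$, that is, a smooth closed non-degenerate $2$-form, and let $0<k<n$. Write $\omega^k=\omega\wedge\dots\wedge\omega$ ($k$ factors). For a differential form $\eta$ on $M$ let $\mathrm{Diff}(M,\eta)$ be the group of diffeomorphisms $\varphi$ of $M$ with $\varphi^*\eta=\eta$, and let its identity component $\mathrm{Diff}_0(M,\eta)$ consist of those $\varphi$ for which there are diffeomorphisms $f_t\in \mathrm{Diff}(M,\eta)$, $t\in[0,1]$, such that $(x,t)\mapsto f_t(x)$ is a smooth map $M\times[0,1]\to M$, $f_0=\mathrm{id}$ and $f_1=\varphi$. Put $\mathrm{Symp}(M,\omega)=\mathrm{Diff}(M,\omega)$ and $\mathrm{Symp}_0(M,\omega)=\mathrm{Diff}_0(M,\omega)$. Then every element of $\mathrm{Diff}_0(M,\omega^k)$ is a symplectomorphism, i.e. $\mathrm{Diff}_0(M,\omega^k)\subseteq\mathrm{Symp}(M,\omega)$, and $$\mathrm{Diff}_0(M,\omega^k)=\mathrm{Symp}_0(M,\omega).$$ -/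

import Mathlib

open scoped Manifold ContDiff

noncomputable section

namespace SymplecticPowers

/-! ### Exterior algebra of a real vector space -/

section Linear

variable {V : Type*} [AddCommGroup V] [Module ℝ V]

/-- The wedge product of a `p`-form and a `q`-form on a real vector space:
the signed sum over `(p, q)`-shuffles of the products of values. -/
def wedge {p q : ℕ} (a : V [⋀^Fin p]→ₗ[ℝ] ℝ) (b : V [⋀^Fin q]→ₗ[ℝ] ℝ) :
    V [⋀^Fin (p + q)]→ₗ[ℝ] ℝ :=
  ((LinearMap.mul' ℝ ℝ).compAlternatingMap (a.domCoprod b)).domDomCongr finSumFinEquiv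

/-- The exterior power `a ∧ ⋯ ∧ a` (`k` factors) of a 2-form `a`; for `k = 0` it is the
constant `1`. -/
def wedgePow (a : V [⋀^Fin 2]→ₗ[ℝ] ℝ) : (k : ℕ) → V [⋀^Fin (2 * k)]→ₗ[ℝ] ℝ
  | 0 => AlternatingMap.constOfIsEmpty ℝ V (Fin 0) 1
  | k + 1 => wedge (wedgePow a k) a

end Linear

/-! ### Forms on a manifold without boundary of dimension `m` -/

section Manifold

variable {m : ℕ} {M : Type*} [TopologicalSpace M] [ChartedSpace (EuclideanSpace ℝ (Fin m)) M]

/-- The coordinate expression of a 2-form `Ω` in the chart around `x₀`: the pullback of `Ω` under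
the inverse of the chart. It is meaningful on the (open) target of the chart. -/
def chartForm (Ω : ∀ x : M, TangentSpace (𝓡 m) x [⋀^Fin 2]→L[ℝ] ℝ) (x₀ : M)
    (y : EuclideanSpace ℝ (Fin m)) : EuclideanSpace ℝ (Fin m) [⋀^Fin 2]→L[ℝ] ℝ :=
  (Ω ((extChartAt (𝓡 m) x₀).symm y)).compContinuousLinearMap
    (mfderiv 𝓘(ℝ, EuclideanSpace ℝ (Fin m)) (𝓡 m) (extChartAt (𝓡 m) x₀).symm y)

/-- A symplectic form: a smooth, closed, nondegenerate 2-form. -/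
structure IsSymplecticForm (Ω : ∀ x : M, TangentSpace (𝓡 m) x [⋀^Fin 2]→L[ℝ] ℝ) : Prop where
  smooth : ∀ x₀ : M, ContDiffOn ℝ ∞ (chartForm Ω x₀) (extChartAt (𝓡 m) x₀).target
  closed : ∀ x₀ : M, ∀ y ∈ (extChartAt (𝓡 m) x₀).target, extDeriv (chartForm Ω x₀) y = 0
  nondegenerate : ∀ (x : M) (v : TangentSpace (𝓡 m) x), (∀ w, Ω x ![v, w] = 0) → v = 0

/-- The 2-form `Ω`, as a field of alternating forms. -/
def toForm (Ω : ∀ x : M, TangentSpace (𝓡 m) x [⋀^Fin 2]→L[ℝ] ℝ) (x : M) :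
    TangentSpace (𝓡 m) x [⋀^Fin 2]→ₗ[ℝ] ℝ :=
  (Ω x).toAlternatingMap

/-- The `2k`-form `Ω ^ k`. -/
def formPow (Ω : ∀ x : M, TangentSpace (𝓡 m) x [⋀^Fin 2]→L[ℝ] ℝ) (k : ℕ) (x : M) :
    TangentSpace (𝓡 m) x [⋀^Fin (2 * k)]→ₗ[ℝ] ℝ :=
  wedgePow (toForm Ω x) k

/-- The pullback of a `p`-form `η` under a map `φ : M → M`. -/
def pullback {p : ℕ} (φ : M → M) (η : ∀ x : M, TangentSpace (𝓡 m) x [⋀^Fin p]→ₗ[ℝ] ℝ) (x : M) :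
    TangentSpace (𝓡 m) x [⋀^Fin p]→ₗ[ℝ] ℝ :=
  (η (φ x)).compLinearMap (mfderiv (𝓡 m) (𝓡 m) φ x).toLinearMap

/-- The diffeomorphisms of `M` that preserve the form `η`. -/
def DiffPreserving {p : ℕ} (η : ∀ x : M, TangentSpace (𝓡 m) x [⋀^Fin p]→ₗ[ℝ] ℝ) :
    Set (M ≃ₘ⟮𝓡 m, 𝓡 m⟯ M) :=
  {φ | pullback φ η = η}

/-- The identity component of the diffeomorphisms preserving `η`: those `φ` that are joined to the
identity by a path `f t`, `0 ≤ t ≤ 1`, of `η`-preserving diffeomorphisms such that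
`(x, t) ↦ f t x` is smooth on `M × [0, 1]`. The values of `f` outside `[0, 1]` are irrelevant. -/
def DiffPreserving₀ {p : ℕ} (η : ∀ x : M, TangentSpace (𝓡 m) x [⋀^Fin p]→ₗ[ℝ] ℝ) :
    Set (M ≃ₘ⟮𝓡 m, 𝓡 m⟯ M) :=
  {φ | ∃ f : ℝ → (M ≃ₘ⟮𝓡 m, 𝓡 m⟯ M),
    ContMDiffOn ((𝓡 m).prod 𝓘(ℝ, ℝ)) (𝓡 m) ∞ (fun q : M × ℝ => f q.2 q.1)
      (Set.univ ×ˢ Set.Icc (0 : ℝ) 1) ∧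
    (∀ t ∈ Set.Icc (0 : ℝ) 1, f t ∈ DiffPreserving η) ∧
    f 0 = Diffeomorph.refl (𝓡 m) M ∞ ∧ f 1 = φ}

/-- `Symp(M, Ω)`, the symplectomorphisms. -/
def Symp (Ω : ∀ x : M, TangentSpace (𝓡 m) x [⋀^Fin 2]→L[ℝ] ℝ) : Set (M ≃ₘ⟮𝓡 m, 𝓡 m⟯ M) :=
  DiffPreserving (toForm Ω)

/-- `Symp₀(M, Ω)`, the identity component of the group of symplectomorphisms. -/
def Symp₀ (Ω : ∀ x : M, TangentSpace (𝓡 m) x [⋀^Fin 2]→L[ℝ] ℝ) : Set (M ≃ₘ⟮𝓡 m, 𝓡 m⟯ M) :=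
  DiffPreserving₀ (toForm Ω)

/-- `Diff₀(M, Ω ^ k)`, the identity component of the group of `Ω ^ k`-preserving
diffeomorphisms. -/
def DiffPow₀ (Ω : ∀ x : M, TangentSpace (𝓡 m) x [⋀^Fin 2]→L[ℝ] ℝ) (k : ℕ) :
    Set (M ≃ₘ⟮𝓡 m, 𝓡 m⟯ M) :=
  DiffPreserving₀ (formPow Ω k)

end Manifold

end SymplecticPowers

end

open scoped Manifold ContDiff

noncomputable section

/-! The core is pointwise linear algebra: if `o` is nondegenerate, 0 < 2k < dim V and a^k = o^k,
then a = ±o (`eq_or_eq_neg_of_wedgePow_eq`). It suffices that o(v, u) = 0 forces a(v, u) = 0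
(`orthogonal_of_wedgePow_eq`), for then a = c • o, and c^k = 1.

For that, assume u is not a multiple of v, and choose in the `o`-orthogonal of v a symplectic frame
w of 2k vectors containing u (`exists_isFrame`). On the 2k + 1 vectors v, w the form `a` has an
antisymmetric Gram matrix of odd size, so some nontrivial combination x of them is `a`-orthogonal to
all of them. Replacing w_i by x kills a^k; in o^k only the term c_i o^k(w) survives, and o^k(w) ≠ 0.
So x is a nonzero multiple of v, and a(v, u) = 0.

Along a path, f_t^*Ω = ±Ω at each point; by continuity in t (`continuousOn_pullback_apply`) the sign
remains + from the identity on. The converse inclusion is naturality of the wedge product. -/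

namespace SymplecticPowers

/-! ### Powers of a 2-form as sums over permutations. -/

section ExteriorPower

variable {V W : Type*} [AddCommGroup V] [Module ℝ V] [AddCommGroup W] [Module ℝ W]

/-- The enumeration of `Fin (2 * k)` by consecutive pairs: `(i, j) ↦ 2 * i + j`. -/
def pairEquiv (k : ℕ) : Fin k × Fin 2 ≃ Fin (2 * k) :=
  finProdFinEquiv.trans (finCongr (Nat.mul_comm k 2))

theorem pairEquiv_val (k : ℕ) (i : Fin k) (j : Fin 2) :
    (pairEquiv k (i, j) : ℕ) = j + 2 * i := rfl

/-- The `k`-th tensor power of a bilinear map, evaluated on consecutive pairs of vectors. -/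
def tensorPow (B : MultilinearMap ℝ (fun _ : Fin 2 => V) ℝ) :
    (k : ℕ) → MultilinearMap ℝ (fun _ : Fin (2 * k) => V) ℝ
  | 0 => MultilinearMap.constOfIsEmpty ℝ (fun _ : Fin 0 => V) 1
  | k + 1 => ((LinearMap.mul' ℝ ℝ).compMultilinearMap
      ((tensorPow B k).domCoprod B)).domDomCongr finSumFinEquiv

theorem tensorPow_apply (B : MultilinearMap ℝ (fun _ : Fin 2 => V) ℝ) (k : ℕ)
    (v : Fin (2 * k) → V) :
    tensorPow B k v = ∏ i : Fin k, B fun j => v (pairEquiv k (i, j)) := by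
  induction k with
  | zero => simp [tensorPow]
  | succ k ih =>
    rw [Fin.prod_univ_castSucc]
    simp only [tensorPow, MultilinearMap.domDomCongr_apply,
      LinearMap.compMultilinearMap_apply, MultilinearMap.domCoprod_apply, LinearMap.mul'_apply]
    rw [ih]
    congr 1
    congr 1
    funext j
    congr 1
    ext
    rw [pairEquiv_val, Fin.val_last]
    exact (congrArg Fin.val (finSumFinEquiv_apply_right (m := 2 * k) j)).trans (add_comm _ _)

theorem alternatization_domDomCongr {ι κ : Type*} [Fintype ι] [DecidableEq ι] [Fintype κ]
    [DecidableEq κ] (e : ι ≃ κ) (A : MultilinearMap ℝ (fun _ : ι => V) ℝ) :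
    MultilinearMap.alternatization (A.domDomCongr e) =
      (MultilinearMap.alternatization A).domDomCongr e := by
  ext v
  simp only [AlternatingMap.domDomCongr_apply, MultilinearMap.alternatization_apply,
    MultilinearMap.domDomCongr_apply]
  refine (Fintype.sum_equiv e.permCongr _ _ fun σ => ?_).symm
  simp

/-- With the shuffle convention for `wedge`, alternatization carries tensor products to wedge
products without factorial factors. -/
theorem wedgePow_alternatization (B : MultilinearMap ℝ (fun _ : Fin 2 => V) ℝ) (k : ℕ) :
    wedgePow (MultilinearMap.alternatization B) k =
      MultilinearMap.alternatization (tensorPow B k) := by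
  induction k with
  | zero =>
    ext v
    simp only [wedgePow, tensorPow, MultilinearMap.alternatization_apply]
    have : Unique (Equiv.Perm (Fin (2 * 0))) := inferInstanceAs (Unique (Equiv.Perm (Fin 0)))
    have hs (σ : Equiv.Perm (Fin (2 * 0))) : Equiv.Perm.sign σ = 1 := by
      rw [Subsingleton.elim σ 1, Equiv.Perm.sign_one]
    rw [Fintype.sum_unique, hs, one_smul]
    rfl
  | succ k ih =>
    simp only [wedgePow, tensorPow, wedge, ih]
    rw [alternatization_domDomCongr, LinearMap.compMultilinearMap_alternatization,
      MultilinearMap.domCoprod_alternization]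

theorem wedgePow_alternatization_apply (B : MultilinearMap ℝ (fun _ : Fin 2 => V) ℝ) (k : ℕ)
    (v : Fin (2 * k) → V) :
    wedgePow (MultilinearMap.alternatization B) k v =
      ∑ σ : Equiv.Perm (Fin (2 * k)), Equiv.Perm.sign σ •
        ∏ i : Fin k, B fun j => v (σ (pairEquiv k (i, j))) := by
  rw [wedgePow_alternatization, MultilinearMap.alternatization_apply]
  simp [tensorPow_apply]

/-- Alternatizing a 2-form multiplies it by 2!, hence the factor 1/2. Naturality, homogeneity and
vanishing of powers are read off from this formula. -/
theorem wedgePow_apply (a : V [⋀^Fin 2]→ₗ[ℝ] ℝ) (k : ℕ) (v : Fin (2 * k) → V) :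
    wedgePow a k v = ∑ σ : Equiv.Perm (Fin (2 * k)), Equiv.Perm.sign σ •
        ∏ i : Fin k, (1 / 2 : ℝ) * a fun j => v (σ (pairEquiv k (i, j))) := by
  have h : a = MultilinearMap.alternatization ((1 / 2 : ℝ) • (a : MultilinearMap ℝ _ ℝ)) := by
    ext w
    have := congrArg (fun b => b w) (AlternatingMap.coe_alternatization a)
    simp only [MultilinearMap.alternatization_apply, AlternatingMap.smul_apply] at this
    simp only [MultilinearMap.alternatization_apply, MultilinearMap.domDomCongr_apply,
      _root_.smul_apply] at this ⊢
    rw [Finset.sum_congr rfl fun σ _ => smul_comm _ _ _, ← Finset.smul_sum, this]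
    simp
  conv_lhs => rw [h]
  rw [wedgePow_alternatization_apply]
  rfl

theorem wedgePow_compLinearMap (a : V [⋀^Fin 2]→ₗ[ℝ] ℝ) (L : W →ₗ[ℝ] V) (k : ℕ) :
    wedgePow (a.compLinearMap L) k = (wedgePow a k).compLinearMap L := by
  ext v
  simp only [AlternatingMap.compLinearMap_apply, wedgePow_apply]

theorem wedgePow_smul (c : ℝ) (a : V [⋀^Fin 2]→ₗ[ℝ] ℝ) (k : ℕ) :
    wedgePow (c • a) k = c ^ k • wedgePow a k := by
  ext v
  simp only [AlternatingMap.smul_apply, wedgePow_apply, smul_eq_mul, Finset.mul_sum]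
  refine Finset.sum_congr rfl fun σ _ => ?_
  rw [← smul_eq_mul (c ^ k), smul_comm, smul_eq_mul]
  congr 1
  simp_rw [mul_left_comm _ c, Finset.prod_mul_distrib]
  simp

/-- A power of a 2-form vanishes on a family containing a vector orthogonal to all the others. -/
theorem wedgePow_eq_zero_of_orthogonal (a : V [⋀^Fin 2]→ₗ[ℝ] ℝ) (k : ℕ) (v : Fin (2 * k) → V)
    (p : Fin (2 * k)) (h : ∀ q, q ≠ p → a ![v p, v q] = 0) : wedgePow a k v = 0 := by
  rw [wedgePow_apply]
  refine Finset.sum_eq_zero fun σ _ => ?_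
  -- For each `σ`, the index `p` sits in exactly one pair, and the factor of that pair is zero.
  obtain ⟨⟨i, j⟩, hij⟩ := (pairEquiv k).surjective (σ.symm p)
  have hp : σ (pairEquiv k (i, j)) = p := by simp [hij]
  have hne : ∀ j', j' ≠ j → σ (pairEquiv k (i, j')) ≠ p := by
    intro j' hj' e
    rw [← hp] at e
    simp [hj'] at e
  rw [Finset.prod_eq_zero (Finset.mem_univ i), smul_zero]
  rw [mul_eq_zero]
  right
  fin_cases j
  · rw [← h _ (hne 1 (by simp)), ← hp]
    congr 1; ext j; fin_cases j <;> rfl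
  · have := h _ (hne 0 (by simp))
    rw [← hp] at this
    have hs := a.map_swap ![v (σ (pairEquiv k (i, 1))), v (σ (pairEquiv k (i, 0)))]
      (i := 0) (j := 1) (by simp)
    rw [show (![v (σ (pairEquiv k (i, 1))), v (σ (pairEquiv k (i, 0)))] ∘ Equiv.swap 0 1) =
      fun j => v (σ (pairEquiv k (i, j))) by ext j; fin_cases j <;> simp] at hs
    rw [hs]
    simpa using this

end ExteriorPower

/-! ### Symplectic frames. -/

section LinearSymplectic

variable {V : Type*} [AddCommGroup V] [Module ℝ V]

theorem update_pair_zero {α : Type*} (x y z : α) : Function.update ![x, y] 0 z = ![z, y] := by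
  ext j; fin_cases j <;> simp

theorem update_pair_one {α : Type*} (x y z : α) : Function.update ![x, y] 1 z = ![x, z] := by
  ext j; fin_cases j <;> simp

/-- The bilinear form `(x, y) ↦ a (x, y)` underlying a 2-form `a`. -/
def bilin (a : V [⋀^Fin 2]→ₗ[ℝ] ℝ) : V →ₗ[ℝ] V →ₗ[ℝ] ℝ :=
  LinearMap.mk₂ ℝ (fun x y => a ![x, y])
    (fun x x' y => by simpa only [update_pair_zero] using a.map_update_add ![x, y] 0 x x')
    (fun c x y => by simpa only [update_pair_zero] using a.map_update_smul ![x, y] 0 c x)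
    (fun x y y' => by simpa only [update_pair_one] using a.map_update_add ![x, y] 1 y y')
    (fun c x y => by simpa only [update_pair_one] using a.map_update_smul ![x, y] 1 c y)

@[simp]
theorem bilin_apply (a : V [⋀^Fin 2]→ₗ[ℝ] ℝ) (x y : V) : bilin a x y = a ![x, y] := rfl

theorem bilin_isAlt (a : V [⋀^Fin 2]→ₗ[ℝ] ℝ) : (bilin a).IsAlt := fun x =>
  a.map_eq_zero_of_eq ![x, x] (i := 0) (j := 1) (by simp) (by simp)

theorem bilin_injective : Function.Injective (bilin : (V [⋀^Fin 2]→ₗ[ℝ] ℝ) → _) := by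
  intro a b h
  ext v
  have h2 := congrArg (fun c => c (v 0) (v 1)) h
  simp only [bilin_apply] at h2
  have hv : ![v 0, v 1] = v := by ext j; fin_cases j <;> rfl
  rwa [hv] at h2

/-- A symplectic frame for the bilinear form `b`: vectors `e i`, `f i` with `b (e i) (f j) = δ i j`
and all other products zero. -/
structure IsFrame (b : V →ₗ[ℝ] V →ₗ[ℝ] ℝ) {k : ℕ} (e f : Fin k → V) : Prop where
  left : ∀ i j, b (e i) (e j) = 0
  right : ∀ i j, b (f i) (f j) = 0
  dual : ∀ i j, b (e i) (f j) = if i = j then 1 else 0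

/-- In a subspace on which the radical of an alternating form `b` is at most a line, every vector
outside this line starts a symplectic frame of any size permitted by the dimension. -/
theorem exists_isFrame [FiniteDimensional ℝ V] {b : V →ₗ[ℝ] V →ₗ[ℝ] ℝ} (hb : b.IsAlt) (v : V)
    (k : ℕ) (U : Submodule ℝ V)
    (hrad : ∀ x ∈ U, (∀ y ∈ U, b x y = 0) → x ∈ Submodule.span ℝ {v})
    (hdim : 2 * k + 3 ≤ Module.finrank ℝ U) (u : V) (huU : u ∈ U)
    (hu : u ∉ Submodule.span ℝ {v}) :
    ∃ e f : Fin (k + 1) → V, (∀ i, e i ∈ U) ∧ (∀ i, f i ∈ U) ∧ e 0 = u ∧ IsFrame b e f := by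
  induction k generalizing U u with
  | zero =>
    obtain ⟨y, hy, hxy⟩ : ∃ y ∈ U, b u y ≠ 0 := by
      by_contra! h
      exact hu (hrad u huU h)
    refine ⟨fun _ => u, fun _ => (b u y)⁻¹ • y, fun _ => huU, fun _ => U.smul_mem _ hy, rfl,
      ⟨fun _ _ => hb u, fun _ _ => hb _, fun i j => ?_⟩⟩
    have hij : i = j := Subsingleton.elim (α := Fin 1) i j
    simp [hxy, hij]
  | succ k ih =>
    obtain ⟨y, hy, hxy⟩ : ∃ y ∈ U, b u y ≠ 0 := by
      by_contra! h
      exact hu (hrad u huU h)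
    obtain ⟨w, hw, huw⟩ : ∃ w ∈ U, b u w = 1 :=
      ⟨(b u y)⁻¹ • y, U.smul_mem _ hy, by simp [hxy]⟩
    have hwu : b w u = -1 := by rw [← hb.neg, huw]
    -- Split off the hyperbolic plane of `u`, `w` and recurse in its orthogonal, which loses at most
    -- two dimensions.
    let U' : Submodule ℝ V := U ⊓ LinearMap.ker (b u) ⊓ LinearMap.ker (b w)
    have hmem : ∀ x, x ∈ U' ↔ x ∈ U ∧ b u x = 0 ∧ b w x = 0 := fun x => by
      simp [U', and_assoc]
    -- Projection onto `U'` along the plane; through it, a radical vector of `U'` is also radical in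
    -- `U`.
    have hproj : ∀ y ∈ U, y + b w y • u - b u y • w ∈ U' := by
      intro y hy
      rw [hmem]
      refine ⟨U.sub_mem (U.add_mem hy (U.smul_mem _ huU)) (U.smul_mem _ hw), ?_, ?_⟩
      · simp [huw, hb u]
      · simp [hwu, hb w]
    have hrad' : ∀ x ∈ U', (∀ y ∈ U', b x y = 0) → x ∈ Submodule.span ℝ {v} := by
      intro x hx h
      obtain ⟨hxU, hux, hwx⟩ := (hmem x).1 hx
      refine hrad x hxU fun y hy => ?_
      have h1 := h _ (hproj y hy)
      have h2 : b x u = 0 := by rw [← hb.neg, hux, neg_zero]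
      have h3 : b x w = 0 := by rw [← hb.neg, hwx, neg_zero]
      simpa [h2, h3] using h1
    have hle : U ≤ U' ⊔ Submodule.span ℝ ({u, w} : Set V) := by
      intro y hy
      have hd : y = (y + b w y • u - b u y • w) + (b u y • w - b w y • u) := by abel
      rw [hd]
      refine Submodule.add_mem_sup (hproj y hy) (Submodule.sub_mem _ ?_ ?_)
      · exact Submodule.smul_mem _ _ (Submodule.subset_span (by simp))
      · exact Submodule.smul_mem _ _ (Submodule.subset_span (by simp))
    have hspan : Module.finrank ℝ (Submodule.span ℝ ({u, w} : Set V)) ≤ 2 := by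
      classical
      have h := finrank_span_finset_le_card (R := ℝ) ({u, w} : Finset V)
      rw [Finset.coe_pair] at h
      exact h.trans Finset.card_le_two
    have hdim' : 2 * k + 3 ≤ Module.finrank ℝ U' := by
      have h1 := Submodule.finrank_mono hle
      have h2 := Submodule.finrank_add_le_finrank_add_finrank U'
        (Submodule.span ℝ ({u, w} : Set V))
      omega
    obtain ⟨u', hu'U, hu'⟩ : ∃ u' ∈ U', u' ∉ Submodule.span ℝ {v} := by
      by_contra! h
      have h1 := Submodule.finrank_mono (show U' ≤ Submodule.span ℝ {v} from h)
      have h2 : Module.finrank ℝ (Submodule.span ℝ {v}) ≤ 1 := by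
        simpa using finrank_span_le_card (R := ℝ) ({v} : Set V)
      omega
    obtain ⟨e, f, he, hf, -, hF⟩ := ih U' hrad' hdim' u' hu'U hu'
    have hsymm : ∀ x y, b x y = 0 → b y x = 0 := fun x y h => by rw [← hb.neg, h, neg_zero]
    refine ⟨Fin.cons u e, Fin.cons w f, ?_, ?_, rfl, ⟨?_, ?_, ?_⟩⟩
    · exact Fin.cases huU fun i => ((hmem _).1 (he i)).1
    · exact Fin.cases hw fun i => ((hmem _).1 (hf i)).1
    · refine Fin.cases (Fin.cases (hb u) fun j => ?_) fun i => Fin.cases ?_ fun j => ?_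
      · exact ((hmem _).1 (he j)).2.1
      · exact hsymm _ _ ((hmem _).1 (he i)).2.1
      · exact hF.left i j
    · refine Fin.cases (Fin.cases (hb w) fun j => ?_) fun i => Fin.cases ?_ fun j => ?_
      · exact ((hmem _).1 (hf j)).2.2
      · exact hsymm _ _ ((hmem _).1 (hf i)).2.2
      · exact hF.right i j
    · refine Fin.cases (Fin.cases ?_ fun j => ?_) fun i => Fin.cases ?_ fun j => ?_
      · simpa using huw
      · simpa [(Fin.succ_ne_zero j).symm] using ((hmem _).1 (hf j)).2.1
      · simpa [Fin.succ_ne_zero i] using hsymm _ _ ((hmem _).1 (he i)).2.2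
      · simpa using hF.dual i j

end LinearSymplectic

/-! ### Nonvanishing of the power on a frame. -/

section Frame

/-- The vectors of a frame in the order `e 0, f 0, e 1, f 1, …`. -/
def frameVec {V : Type*} {k : ℕ} (e f : Fin k → V) (p : Fin (2 * k)) : V :=
  ![e ((pairEquiv k).symm p).1, f ((pairEquiv k).symm p).1] ((pairEquiv k).symm p).2

@[simp]
theorem frameVec_pairEquiv_zero {V : Type*} {k : ℕ} (e f : Fin k → V) (i : Fin k) :
    frameVec e f (pairEquiv k (i, 0)) = e i := by simp [frameVec]

@[simp]
theorem frameVec_pairEquiv_one {V : Type*} {k : ℕ} (e f : Fin k → V) (i : Fin k) :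
    frameVec e f (pairEquiv k (i, 1)) = f i := by simp [frameVec]

variable {V : Type*} [AddCommGroup V] [Module ℝ V]

/-- The bilinear map `(x, y) ↦ ∑ i, x (2 i) * y (2 i + 1)`. -/
def halfForm (k : ℕ) : MultilinearMap ℝ (fun _ : Fin 2 => Fin (2 * k) → ℝ) ℝ :=
  ∑ i : Fin k, (MultilinearMap.mkPiAlgebra ℝ (Fin 2) ℝ).compLinearMap
    fun j => LinearMap.proj (pairEquiv k (i, j))

theorem halfForm_apply (k : ℕ) (v : Fin 2 → Fin (2 * k) → ℝ) :
    halfForm k v = ∑ i : Fin k, v 0 (pairEquiv k (i, 0)) * v 1 (pairEquiv k (i, 1)) := by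
  simp [halfForm, Fin.prod_univ_two]

theorem halfForm_single (k : ℕ) (p : Fin 2 → Fin (2 * k)) :
    halfForm k (fun j => Pi.single (p j) 1) =
      if ∃ i, p 0 = pairEquiv k (i, 0) ∧ p 1 = pairEquiv k (i, 1) then 1 else 0 := by
  classical
  rw [halfForm_apply]
  split_ifs with h
  · obtain ⟨i, h0, h1⟩ := h
    rw [Finset.sum_eq_single i]
    · simp [h0, h1]
    · intro i' _ hi'
      simp [h0, Pi.single_apply, hi']
    · simp
  · refine Finset.sum_eq_zero fun i _ => ?_
    simp only [Pi.single_apply]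
    split_ifs with h0 h1
    · exact absurd ⟨i, h0.symm, h1.symm⟩ h
    all_goals simp

/-- A permutation that maps consecutive pairs to consecutive pairs is even. -/
theorem sign_eq_one_of_pairs {k : ℕ} (σ : Equiv.Perm (Fin (2 * k)))
    (h : ∀ i, ∃ i', σ (pairEquiv k (i, 0)) = pairEquiv k (i', 0) ∧
      σ (pairEquiv k (i, 1)) = pairEquiv k (i', 1)) : Equiv.Perm.sign σ = 1 := by
  choose τ h0 h1 using h
  have hτ : Function.Injective τ := by
    intro i i' hi
    have := h0 i
    rw [hi, ← h0 i'] at this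
    simpa using this
  let τ' : Equiv.Perm (Fin k) := Equiv.ofBijective τ (Finite.injective_iff_bijective.1 hτ)
  -- `σ` acts by the same `τ'` in both slots, so its sign is a square.
  have hσ : σ = (pairEquiv k).permCongr (Equiv.prodCongrLeft fun _ : Fin 2 => τ') := by
    ext1 p
    obtain ⟨⟨i, j⟩, rfl⟩ := (pairEquiv k).surjective p
    fin_cases j
    · simpa [Equiv.permCongr_apply, τ'] using h0 i
    · simpa [Equiv.permCongr_apply, τ'] using h1 i
  rw [hσ, Equiv.Perm.sign_permCongr, Equiv.Perm.sign_prodCongrLeft]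
  simp

/-- Only permutations preserving the ordered pairs contribute. These are even, so nothing cancels,
and the identity contributes 1. -/
theorem wedgePow_halfForm_pos (k : ℕ) :
    0 < wedgePow (MultilinearMap.alternatization (halfForm k)) k
      (fun p : Fin (2 * k) => (Pi.single p 1 : Fin (2 * k) → ℝ)) := by
  classical
  rw [wedgePow_alternatization_apply]
  simp_rw [halfForm_single]
  refine Finset.sum_pos' (fun σ _ => ?_) ⟨1, Finset.mem_univ _, ?_⟩
  · by_cases h : ∀ i, ∃ i', σ (pairEquiv k (i, 0)) = pairEquiv k (i', 0) ∧
      σ (pairEquiv k (i, 1)) = pairEquiv k (i', 1)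
    · rw [sign_eq_one_of_pairs σ h, one_smul]
      exact Finset.prod_nonneg fun i _ => by split_ifs <;> norm_num
    · push Not at h
      obtain ⟨i, hi⟩ := h
      rw [Finset.prod_eq_zero (Finset.mem_univ i), smul_zero]
      rw [if_neg]
      rintro ⟨i', h0, h1⟩
      exact hi i' h0 h1
  · simp

theorem alternatization_fin_two (B : MultilinearMap ℝ (fun _ : Fin 2 => V) ℝ) (v : Fin 2 → V) :
    MultilinearMap.alternatization B v = B v - B fun j => v (Equiv.swap 0 1 j) := by
  have hu : (Finset.univ : Finset (Equiv.Perm (Fin 2))) = {1, Equiv.swap 0 1} := by decide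
  rw [MultilinearMap.alternatization_apply, hu, Finset.sum_pair (by decide)]
  simp [sub_eq_add_neg]

/-- The frame relations say that `a`, pulled back to ℝ^(2k) by sending the standard basis to the
frame, is the standard symplectic form. -/
theorem wedgePow_frame_ne_zero (a : V [⋀^Fin 2]→ₗ[ℝ] ℝ) {k : ℕ} {e f : Fin k → V}
    (h : IsFrame (bilin a) e f) : wedgePow a k (frameVec e f) ≠ 0 := by
  classical
  let L : (Fin (2 * k) → ℝ) →ₗ[ℝ] V := Fintype.linearCombination ℝ (frameVec e f)
  have hL : ∀ p, L (Pi.single p 1) = frameVec e f p := fun p => by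
    simp [L]
  have hbil : ∀ p q, a.compLinearMap L ![Pi.single p 1, Pi.single q 1] =
      a ![frameVec e f p, frameVec e f q] := by
    intro p q
    rw [AlternatingMap.compLinearMap_apply]
    congr 1
    ext j
    fin_cases j <;> simp [hL]
  have hLa : a.compLinearMap L = MultilinearMap.alternatization (halfForm k) := by
    refine (Pi.basisFun ℝ (Fin (2 * k))).ext_alternating fun p hp => ?_
    have hpp : (fun j => Pi.basisFun ℝ (Fin (2 * k)) (p j)) =
      ![Pi.single (p 0) 1, Pi.single (p 1) 1] := by
      ext j : 1; fin_cases j <;> simp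
    rw [hpp, hbil, ← hpp]
    rw [alternatization_fin_two]
    simp only [Pi.basisFun_apply]
    rw [halfForm_single k p, halfForm_single k fun j => p (Equiv.swap 0 1 j)]
    simp only [Equiv.swap_apply_left, Equiv.swap_apply_right]
    obtain ⟨⟨i₀, j₀⟩, h₀⟩ := (pairEquiv k).surjective (p 0)
    obtain ⟨⟨i₁, j₁⟩, h₁⟩ := (pairEquiv k).surjective (p 1)
    simp only [← h₀, ← h₁, EmbeddingLike.apply_eq_iff_eq, Prod.mk.injEq]
    rw [← bilin_apply]
    fin_cases j₀ <;> fin_cases j₁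
    · simpa using h.left i₀ i₁
    · simpa [eq_comm] using h.dual i₀ i₁
    · rw [← (bilin_isAlt a).neg]
      simpa [eq_comm] using h.dual i₁ i₀
    · simpa using h.right i₀ i₁
  have := wedgePow_halfForm_pos k
  rw [← hLa, wedgePow_compLinearMap, AlternatingMap.compLinearMap_apply] at this
  simp_rw [hL] at this
  exact this.ne'

end Frame

/-! ### A 2-form is determined up to sign by its power. -/

section Rigidity

variable {V : Type*} [AddCommGroup V] [Module ℝ V]

/-- An alternating bilinear form on an odd number of vectors has a nontrivial kernel vector. -/
theorem exists_kernel_vector {ι : Type*} [Fintype ι] (hι : Odd (Fintype.card ι))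
    {b : V →ₗ[ℝ] V →ₗ[ℝ] ℝ} (hb : b.IsAlt) (z : ι → V) :
    ∃ c : ι → ℝ, c ≠ 0 ∧ ∀ p, b (z p) (∑ q, c q • z q) = 0 := by
  classical
  let A : Matrix ι ι ℝ := Matrix.of fun p q => b (z p) (z q)
  have hA : A.transpose = -A := by
    ext p q
    simp [A, hb.neg]
  have hdet : A.det = 0 := by
    have h := A.det_transpose
    rw [hA, Matrix.det_neg, hι.neg_one_pow] at h
    linarith
  obtain ⟨c, hc, hAc⟩ := Matrix.exists_mulVec_eq_zero_iff.2 hdet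
  refine ⟨c, hc, fun p => ?_⟩
  have := congrFun hAc p
  simpa [A, Matrix.mulVec, dotProduct, mul_comm] using this

/-- If `a ^ k = o ^ k` with `o` nondegenerate and `2 * k < dim V`, then `o`-orthogonal vectors are
`a`-orthogonal. -/
theorem orthogonal_of_wedgePow_eq [FiniteDimensional ℝ V] {a o : V [⋀^Fin 2]→ₗ[ℝ] ℝ} {k : ℕ}
    (hdim : 2 * (k + 1) + 2 ≤ Module.finrank ℝ V) (ho : ∀ x, bilin o x = 0 → x = 0)
    (h : wedgePow a (k + 1) = wedgePow o (k + 1)) {v u : V} (hvu : bilin o v u = 0) :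
    bilin a v u = 0 := by
  classical
  by_cases hu : u ∈ Submodule.span ℝ {v}
  · obtain ⟨c, rfl⟩ := Submodule.mem_span_singleton.1 hu
    rw [map_smul, (bilin_isAlt a) v, smul_zero]
  let U := LinearMap.ker (bilin o v)
  have hrad : ∀ x ∈ U, (∀ y ∈ U, bilin o x y = 0) → x ∈ Submodule.span ℝ {v} := by
    intro x _ hx
    -- A functional vanishing on the kernel of `bilin o v` is a multiple of it; nondegeneracy
    -- transfers this to `x` and `v`.
    have hmem : bilin o x ∈ Submodule.span ℝ (Set.range fun _ : Unit => bilin o v) :=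
      mem_span_of_iInf_ker_le_ker fun y hy => by
        simp only [Submodule.mem_iInf] at hy
        exact hx y (hy ())
    rw [Set.range_const] at hmem
    obtain ⟨c, hc⟩ := Submodule.mem_span_singleton.1 hmem
    refine Submodule.mem_span_singleton.2 ⟨c, ?_⟩
    rw [← sub_eq_zero]
    exact ho _ (by rw [map_sub, map_smul, hc, sub_self])
  have hU : 2 * k + 3 ≤ Module.finrank ℝ U := by
    have h1 := LinearMap.finrank_range_add_finrank_ker (bilin o v)
    have h2 := Submodule.finrank_le (LinearMap.range (bilin o v))
    rw [Module.finrank_self] at h2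
    change 2 * k + 3 ≤ Module.finrank ℝ (LinearMap.ker (bilin o v))
    omega
  obtain ⟨e, f, he, hf, he0, hF⟩ := exists_isFrame (bilin_isAlt o) v k U hrad hU u hvu hu
  let w := frameVec e f
  have hw : ∀ p, bilin o v (w p) = 0 := by
    intro p
    obtain ⟨⟨i, j⟩, rfl⟩ := (pairEquiv (k + 1)).surjective p
    fin_cases j
    · simpa [w, -bilin_apply] using LinearMap.mem_ker.1 (he i)
    · simpa [w, -bilin_apply] using LinearMap.mem_ker.1 (hf i)
  have hw0 : wedgePow o (k + 1) w ≠ 0 := wedgePow_frame_ne_zero o hF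
  let z : Option (Fin (2 * (k + 1))) → V := fun p => p.elim v w
  obtain ⟨c, hc, hker⟩ := exists_kernel_vector
    (by rw [Fintype.card_option, Fintype.card_fin]; exact odd_two_mul_add_one _)
    (bilin_isAlt a) z
  set x := ∑ q, c q • z q with hx
  have hc0 : ∀ i, c (some i) = 0 := by
    intro i
    have h1 : wedgePow a (k + 1) (Function.update w i x) = 0 := by
      refine wedgePow_eq_zero_of_orthogonal a _ _ i fun q hq => ?_
      rw [Function.update_self, Function.update_of_ne hq, ← bilin_apply,
        ← (bilin_isAlt a).neg, neg_eq_zero]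
      exact hker (some q)
    have h2 : wedgePow o (k + 1) (Function.update w i v) = 0 := by
      refine wedgePow_eq_zero_of_orthogonal o _ _ i fun q hq => ?_
      rw [Function.update_self, Function.update_of_ne hq, ← bilin_apply, hw]
    have h3 : ∀ q, q ≠ i → wedgePow o (k + 1) (Function.update w i (w q)) = 0 := fun q hq =>
      AlternatingMap.map_update_self _ _ hq.symm
    -- Pass from `a` to `o` and expand `x`: the `v` term dies by orthogonality, the terms with `q ≠
    -- i` by repetition.
    rw [h, hx, AlternatingMap.map_update_sum] at h1
    simp only [AlternatingMap.map_update_smul, Fintype.sum_option] at h1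
    rw [Finset.sum_eq_single i (fun q _ hq => by
      rw [show z (some q) = w q from rfl, h3 q hq, smul_zero]) (by simp)] at h1
    rw [show z none = v from rfl, h2, show z (some i) = w i from rfl,
      Function.update_eq_self, smul_zero, zero_add, smul_eq_mul] at h1
    exact (mul_eq_zero.1 h1).resolve_right hw0
  have hxv : x = c none • v := by
    rw [hx, Fintype.sum_option]
    simp [hc0, z]
  have hcn : c none ≠ 0 := fun h0 => hc (by ext p; cases p <;> simp [h0, hc0])
  have hwu : z (some (pairEquiv (k + 1) (0, 0))) = u := by simp [z, w, he0]
  have := hker (some (pairEquiv (k + 1) (0, 0)))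
  rw [hwu, hxv, map_smul, smul_eq_mul] at this
  rw [← (bilin_isAlt a).neg, (mul_eq_zero.1 this).resolve_left hcn, neg_zero]

/-- A bilinear form vanishing on all orthogonal pairs of a nonzero alternating form is a multiple
of it. -/
theorem exists_eq_smul_of_orthogonal {a o : V →ₗ[ℝ] V →ₗ[ℝ] ℝ} (ho : o.IsAlt)
    (h : ∀ x y, o x y = 0 → a x y = 0) {x₀ y₀ : V} (h0 : o x₀ y₀ = 1) : ∃ c : ℝ, a = c • o := by
  have key : ∀ x y z, a x y * o x z = a x z * o x y := by
    intro x y z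
    -- This combination of `y` and `z` is `o`-orthogonal to `x`.
    have := h x (o x z • y - o x y • z) (by simp [mul_comm])
    simp only [map_sub, map_smul, smul_eq_mul] at this
    linarith
  have haalt : a.IsAlt := fun x => h x x (ho x)
  have hne : ∀ x, o x x₀ ≠ 0 → ∀ y, a x y = a x₀ y₀ * o x y := by
    intro x hx y
    have h1 := key x y x₀
    have h2 := key x₀ x y₀
    rw [h0, mul_one, ← haalt.neg x x₀, ← ho.neg x x₀] at h2
    refine mul_right_cancel₀ hx ?_
    rw [h1]
    linear_combination -o x y * h2
  refine ⟨a x₀ y₀, ?_⟩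
  ext x y
  rw [LinearMap.smul_apply, LinearMap.smul_apply, smul_eq_mul]
  have hy0 : o y₀ x₀ = -1 := by rw [← ho.neg, h0]
  by_cases hx : o x x₀ = 0
  -- Neither `x + y₀` nor `y₀` is orthogonal to `x₀`; subtract the two identities.
  · have h1 := hne (x + y₀) (by simp [hx, hy0]) y
    have h2 := hne y₀ (by simp [hy0]) y
    simp only [map_add, LinearMap.add_apply] at h1
    linarith
  · exact hne x hx y

/-- Over a space of dimension greater than `2 * k`, a nondegenerate 2-form is determined by its
`k`-th power up to sign. -/
theorem eq_or_eq_neg_of_wedgePow_eq [FiniteDimensional ℝ V] {a o : V [⋀^Fin 2]→ₗ[ℝ] ℝ} {k : ℕ}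
    (hk : 0 < k) (hdim : 2 * k + 2 ≤ Module.finrank ℝ V) (ho : ∀ x, bilin o x = 0 → x = 0)
    (h : wedgePow a k = wedgePow o k) : a = o ∨ a = -o := by
  obtain ⟨k, rfl⟩ := Nat.exists_eq_succ_of_ne_zero hk.ne'
  have : Nontrivial V := Module.nontrivial_of_finrank_pos (R := ℝ) (by omega)
  obtain ⟨x₀, hx₀⟩ := exists_ne (0 : V)
  obtain ⟨y, hy⟩ : ∃ y, bilin o x₀ y ≠ 0 := by
    by_contra! hc
    exact hx₀ (ho x₀ (LinearMap.ext hc))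
  obtain ⟨c, hc⟩ := exists_eq_smul_of_orthogonal (bilin_isAlt o)
    (fun x y hxy => orthogonal_of_wedgePow_eq hdim ho h hxy)
    (x₀ := x₀) (y₀ := (bilin o x₀ y)⁻¹ • y) (by simp [-bilin_apply, hy])
  have hac : a = c • o := bilin_injective (by rw [hc]; ext x y; rfl)
  obtain ⟨w, hw⟩ : ∃ w, wedgePow o (k + 1) w ≠ 0 := by
    obtain ⟨e, f, -, -, -, hF⟩ := exists_isFrame (bilin_isAlt o) 0 k ⊤
      (fun x _ hx => by
        rw [ho x (LinearMap.ext fun y => hx y trivial)]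
        exact Submodule.zero_mem _)
      (by rw [finrank_top]; omega) x₀ trivial (by simpa using hx₀)
    exact ⟨_, wedgePow_frame_ne_zero o hF⟩
  rw [hac, wedgePow_smul] at h
  have hck : c ^ (k + 1) = 1 :=
    mul_right_cancel₀ hw ((congrArg (fun b => b w) h).trans (one_mul _).symm)
  have habs : |c| = 1 := by
    have := congrArg abs hck
    rw [abs_pow, abs_one] at this
    exact (pow_eq_one_iff_of_nonneg (abs_nonneg c) (by simp)).1 this
  rcases (abs_eq zero_le_one).1 habs with hc1 | hc1
  · left; rw [hac, hc1, one_smul]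
  · right; ext x; simp [hac, hc1]

end Rigidity

/-! ### Continuity of the pulled-back form along a path. -/

section Path

variable {m : ℕ} {M : Type*} [TopologicalSpace M] [ChartedSpace (EuclideanSpace ℝ (Fin m)) M]
  [IsManifold (𝓡 m) ∞ M]

theorem apply_eq_chartForm (Ω : ∀ x : M, TangentSpace (𝓡 m) x [⋀^Fin 2]→L[ℝ] ℝ) {x₀ y : M}
    (hy : y ∈ (extChartAt (𝓡 m) x₀).source) (v : Fin 2 → TangentSpace (𝓡 m) y) :
    Ω y v = chartForm Ω x₀ (extChartAt (𝓡 m) x₀ y)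
      fun j => mfderiv (𝓡 m) 𝓘(ℝ, EuclideanSpace ℝ (Fin m)) (extChartAt (𝓡 m) x₀) y (v j) := by
  have hinv := mfderivWithin_extChartAt_symm_comp_mfderiv_extChartAt' (I := 𝓡 m) hy
  rw [ModelWithCorners.range_eq_univ, mfderivWithin_univ] at hinv
  have hy' := (extChartAt (𝓡 m) x₀).left_inv hy
  have hΩ : ∀ (z : M) (u : Fin 2 → EuclideanSpace ℝ (Fin m)), z = y →
      (Ω z : EuclideanSpace ℝ (Fin m) [⋀^Fin 2]→L[ℝ] ℝ) u = Ω y u := by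
    rintro z u rfl
    rfl
  refine Eq.trans ?_ (hΩ _ _ hy').symm
  congr 1
  ext1 j
  exact (congrArg (fun A : EuclideanSpace ℝ (Fin m) →L[ℝ] EuclideanSpace ℝ (Fin m) => A (v j))
    hinv).symm

/-- In the chart around `f t₀ x`, both the coefficients of `Ω` at `f t x` and the coordinates of the
image vectors vary continuously with `t`. -/
theorem continuousOn_pullback_apply {Ω : ∀ x : M, TangentSpace (𝓡 m) x [⋀^Fin 2]→L[ℝ] ℝ}
    (hΩ : IsSymplecticForm Ω) {f : ℝ → M → M}
    (hf : ContMDiffOn ((𝓡 m).prod 𝓘(ℝ, ℝ)) (𝓡 m) ∞ (fun q : M × ℝ => f q.2 q.1)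
      (Set.univ ×ˢ Set.Icc (0 : ℝ) 1)) (x : M) (v : Fin 2 → TangentSpace (𝓡 m) x) :
    ContinuousOn (fun t => pullback (f t) (toForm Ω) x v) (Set.Icc (0 : ℝ) 1) := by
  intro t₀ ht₀
  have hswap : ContMDiffWithinAt (𝓘(ℝ, ℝ).prod (𝓡 m)) (𝓡 m) ∞ (Function.uncurry f)
      (Set.Icc (0 : ℝ) 1 ×ˢ Set.univ) (t₀, x) := by
    have hsw : ContMDiffWithinAt (𝓘(ℝ, ℝ).prod (𝓡 m)) ((𝓡 m).prod 𝓘(ℝ, ℝ)) ∞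
        (fun q : ℝ × M => (q.2, q.1)) (Set.Icc (0 : ℝ) 1 ×ˢ Set.univ) (t₀, x) :=
      (contMDiff_snd.prodMk contMDiff_fst).contMDiffAt.contMDiffWithinAt
    have hmaps : Set.MapsTo (fun q : ℝ × M => (q.2, q.1)) (Set.Icc (0 : ℝ) 1 ×ˢ Set.univ)
        (Set.univ ×ˢ Set.Icc (0 : ℝ) 1) := fun q hq => ⟨trivial, hq.1⟩
    exact (hf (x, t₀) ⟨trivial, ht₀⟩).comp (t₀, x) hsw hmaps
  have hder := ContMDiffWithinAt.mfderivWithin (m := 0) (g := fun _ : ℝ => x) hswap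
    contMDiffWithinAt_const ht₀ (Set.mapsTo_univ _ _) (by simp) uniqueMDiffOn_univ
  have hcD := hder.continuousWithinAt
  have hcont : ContinuousWithinAt (fun t => f t x) (Set.Icc (0 : ℝ) 1) t₀ := by
    have := hswap.continuousWithinAt.comp (s := Set.Icc (0 : ℝ) 1) (x := t₀)
      (f := fun t : ℝ => (t, x)) (by fun_prop) (fun t ht => ⟨ht, trivial⟩)
    exact this
  let ψ := extChartAt (𝓡 m) (f t₀ x)
  have hsrc : ∀ᶠ t in nhdsWithin t₀ (Set.Icc (0 : ℝ) 1), f t x ∈ ψ.source :=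
    hcont (extChartAt_source_mem_nhds (I := 𝓡 m) (f t₀ x))
  have hform : ContinuousWithinAt (fun t => chartForm Ω (f t₀ x) (ψ (f t x)))
      (Set.Icc (0 : ℝ) 1) t₀ := by
    have h1 : ContinuousAt (chartForm Ω (f t₀ x)) (ψ (f t₀ x)) :=
      (hΩ.smooth (f t₀ x)).continuousOn.continuousAt
        (extChartAt_target_mem_nhds (I := 𝓡 m) (f t₀ x))
    have h2 : ContinuousAt ψ (f t₀ x) := continuousAt_extChartAt (I := 𝓡 m) (f t₀ x)
    exact (h1.comp h2).comp_continuousWithinAt (f := fun t => f t x) hcont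
  have hvec : ∀ j, ContinuousWithinAt (fun t => mfderiv (𝓡 m) 𝓘(ℝ, EuclideanSpace ℝ (Fin m))
      (extChartAt (𝓡 m) (f t₀ x)) (f t x) (mfderiv (𝓡 m) (𝓡 m) (f t) x (v j)))
      (Set.Icc (0 : ℝ) 1) t₀ := by
    intro j
    -- `inTangentCoordinates` first undoes the chart at `x`, so it is fed the coordinate image of `v
    -- j`.
    have hD : ContinuousWithinAt (fun t => inTangentCoordinates (𝓡 m) (𝓡 m) (fun _ : ℝ => x)
        (fun t => f t x) (fun t => mfderiv (𝓡 m) (𝓡 m) (f t) x) t₀ t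
        (mfderiv (𝓡 m) 𝓘(ℝ, EuclideanSpace ℝ (Fin m)) (extChartAt (𝓡 m) x) x (v j)))
        (Set.Icc (0 : ℝ) 1) t₀ := by
      simp only [mfderivWithin_univ] at hcD
      exact hcD.clm_apply continuousWithinAt_const
    have heq : ∀ t, f t x ∈ ψ.source → inTangentCoordinates (𝓡 m) (𝓡 m) (fun _ : ℝ => x)
        (fun t => f t x) (fun t => mfderiv (𝓡 m) (𝓡 m) (f t) x) t₀ t
        (mfderiv (𝓡 m) 𝓘(ℝ, EuclideanSpace ℝ (Fin m)) (extChartAt (𝓡 m) x) x (v j)) =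
        mfderiv (𝓡 m) 𝓘(ℝ, EuclideanSpace ℝ (Fin m)) (extChartAt (𝓡 m) (f t₀ x)) (f t x)
          (mfderiv (𝓡 m) (𝓡 m) (f t) x (v j)) := by
      intro t ht
      rw [inTangentCoordinates_eq_mfderiv_comp (mem_chart_source _ x)
        (by rwa [extChartAt_source] at ht)]
      have hinv := mfderivWithin_extChartAt_symm_comp_mfderiv_extChartAt' (I := 𝓡 m)
        (mem_extChartAt_source (I := 𝓡 m) x)
      have hinv' := congrArg
        (fun A : EuclideanSpace ℝ (Fin m) →L[ℝ] EuclideanSpace ℝ (Fin m) => A (v j)) hinv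
      exact congrArg (fun u : EuclideanSpace ℝ (Fin m) =>
        mfderiv (𝓡 m) 𝓘(ℝ, EuclideanSpace ℝ (Fin m)) (extChartAt (𝓡 m) (f t₀ x)) (f t x)
          (mfderiv (𝓡 m) (𝓡 m) (f t) x u)) hinv'
    exact hD.congr_of_eventuallyEq (hsrc.mono fun t ht => (heq t ht).symm)
      (heq t₀ (mem_extChartAt_source (I := 𝓡 m) (f t₀ x))).symm
  have hpull : ∀ t, f t x ∈ ψ.source → pullback (f t) (toForm Ω) x v =
      chartForm Ω (f t₀ x) (ψ (f t x)) fun j => mfderiv (𝓡 m) 𝓘(ℝ, EuclideanSpace ℝ (Fin m))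
        (extChartAt (𝓡 m) (f t₀ x)) (f t x) (mfderiv (𝓡 m) (𝓡 m) (f t) x (v j)) :=
    fun t ht => apply_eq_chartForm Ω ht _
  refine ContinuousWithinAt.congr_of_eventuallyEq ?_ (hsrc.mono fun t ht => hpull t ht)
    (hpull t₀ (mem_extChartAt_source (I := 𝓡 m) (f t₀ x)))
  have hev : Continuous fun q : (EuclideanSpace ℝ (Fin m) [⋀^Fin 2]→L[ℝ] ℝ) ×
      (Fin 2 → EuclideanSpace ℝ (Fin m)) => q.1 q.2 := by
    fun_prop
  exact hev.continuousAt.comp_continuousWithinAt (hform.prodMk (continuousWithinAt_pi.2 hvec))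

end Path

/-! ### From pointwise signs to the groups. -/

section Main

variable {m : ℕ} {M : Type*} [TopologicalSpace M] [ChartedSpace (EuclideanSpace ℝ (Fin m)) M]

theorem pullback_formPow (φ : M → M) (Ω : ∀ x : M, TangentSpace (𝓡 m) x [⋀^Fin 2]→L[ℝ] ℝ)
    (k : ℕ) (x : M) :
    pullback φ (formPow Ω k) x = wedgePow (pullback φ (toForm Ω) x) k :=
  (wedgePow_compLinearMap _ _ _).symm

theorem symp_subset_diffPreserving_formPow
    (Ω : ∀ x : M, TangentSpace (𝓡 m) x [⋀^Fin 2]→L[ℝ] ℝ) (k : ℕ) :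
    Symp Ω ⊆ DiffPreserving (formPow Ω k) := by
  intro φ hφ
  funext x
  rw [pullback_formPow, show pullback φ (toForm Ω) = toForm Ω from hφ]
  rfl

variable {Ω : ∀ x : M, TangentSpace (𝓡 m) x [⋀^Fin 2]→L[ℝ] ℝ}

theorem pullback_eq_or_eq_neg (hΩ : IsSymplecticForm Ω) {k : ℕ} (hk : 0 < k)
    (hkm : 2 * k + 2 ≤ m) {φ : M → M} (hφ : pullback φ (formPow Ω k) = formPow Ω k) (x : M) :
    pullback φ (toForm Ω) x = toForm Ω x ∨ pullback φ (toForm Ω) x = -toForm Ω x := by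
  have hfin : FiniteDimensional ℝ (TangentSpace (𝓡 m) x) :=
    inferInstanceAs (FiniteDimensional ℝ (EuclideanSpace ℝ (Fin m)))
  have hrank : Module.finrank ℝ (TangentSpace (𝓡 m) x) = m :=
    finrank_euclideanSpace_fin (𝕜 := ℝ) (n := m)
  refine eq_or_eq_neg_of_wedgePow_eq hk (by rwa [hrank]) (fun v hv => ?_) ?_
  · exact hΩ.nondegenerate x v fun w => congrArg (fun b => b w) hv
  · rw [← pullback_formPow, hφ]
    rfl

/-- A path of diffeomorphisms starting at the identity and preserving `Ω ^ k` preserves `Ω`. -/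
theorem mem_symp_of_path [IsManifold (𝓡 m) ∞ M] (hΩ : IsSymplecticForm Ω) {k : ℕ} (hk : 0 < k)
    (hkm : 2 * k + 2 ≤ m) {f : ℝ → (M ≃ₘ⟮𝓡 m, 𝓡 m⟯ M)}
    (hf : ContMDiffOn ((𝓡 m).prod 𝓘(ℝ, ℝ)) (𝓡 m) ∞ (fun q : M × ℝ => f q.2 q.1)
      (Set.univ ×ˢ Set.Icc (0 : ℝ) 1))
    (hpres : ∀ t ∈ Set.Icc (0 : ℝ) 1, f t ∈ DiffPreserving (formPow Ω k))
    (h0 : f 0 = Diffeomorph.refl (𝓡 m) M ∞) {t : ℝ} (ht : t ∈ Set.Icc (0 : ℝ) 1) :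
    f t ∈ Symp Ω := by
  have hpm := fun s (hs : s ∈ Set.Icc (0 : ℝ) 1) x =>
    pullback_eq_or_eq_neg hΩ hk hkm (hpres s hs) x
  funext x
  ext v
  -- `IsPreconnected.eq_of_sq_eq` needs a nonvanishing comparison function; where the value is zero,
  -- either sign gives the claim.
  by_cases hc : toForm Ω x v = 0
  · rcases hpm t ht x with h | h
    · rw [h]
    · rw [h, AlternatingMap.neg_apply, hc, neg_zero]
  have hid : pullback (f 0) (toForm Ω) x v = toForm Ω x v := by
    rw [h0]
    simp only [pullback, Diffeomorph.coe_refl, mfderiv_id]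
    rfl
  refine isPreconnected_Icc.eq_of_sq_eq (g := fun _ => toForm Ω x v)
    (continuousOn_pullback_apply hΩ (f := fun t => f t) hf x v) continuousOn_const
    (fun s hs => ?_) (fun _ => hc) (Set.left_mem_Icc.2 zero_le_one) hid ht
  rcases hpm s hs x with h | h <;> simp [h]

end Main

end SymplecticPowers

end

open scoped Manifold ContDiff in
theorem theorem1 (n k : ℕ) (hn : 2 < n) (hk : 0 < k) (hkn : k < n)
    (M : Type*) [TopologicalSpace M] [ChartedSpace (EuclideanSpace ℝ (Fin (2 * n))) M]
    [IsManifold (𝓡 (2 * n)) ∞ M]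
    (Ω : ∀ x : M, TangentSpace (𝓡 (2 * n)) x [⋀^Fin 2]→L[ℝ] ℝ)
    (hΩ : SymplecticPowers.IsSymplecticForm Ω) :
    SymplecticPowers.DiffPow₀ Ω k ⊆ SymplecticPowers.Symp Ω ∧
      SymplecticPowers.DiffPow₀ Ω k = SymplecticPowers.Symp₀ Ω := by
  have hkm : 2 * k + 2 ≤ 2 * n := by omega
  refine ⟨?_, Set.Subset.antisymm ?_ ?_⟩
  · rintro φ ⟨f, hf, hpres, h0, rfl⟩
    exact SymplecticPowers.mem_symp_of_path hΩ hk hkm hf hpres h0 (Set.right_mem_Icc.2 zero_le_one)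
  · rintro φ ⟨f, hf, hpres, h0, h1⟩
    exact ⟨f, hf, fun t ht => SymplecticPowers.mem_symp_of_path hΩ hk hkm hf hpres h0 ht, h0, h1⟩
  · rintro φ ⟨f, hf, hpres, h0, h1⟩
    exact ⟨f, hf, fun t ht =>
      SymplecticPowers.symp_subset_diffPreserving_formPow Ω k (hpres t ht), h0, h1⟩
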